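/- Let $-\infty<\alpha<\infty$, $0\le\beta\le 1$, and let $f:\mathbb D\to\mathbb C$ either be univalent (holomorphic and injective) on the unit disc $\mathbb D$, or be of the form $f(z)=a_0+a_nz^n$ with $a_0,a_n\in\mathbb C$ and an integer $n\ge 1$. For $0<t<1$ let $L(f,t)$ be the Euclidean length (one-dimensional Hausdorff measure) of the boundary $\partial f(t\mathbb D)$ of the image of $t\mathbb D=\{|z|<t\}$, and put $$\Phi_{L,\beta}(f,t)=\frac{L(f,t)}{(2\pi t)^\beta},\qquad d\mu_\alpha(t)=(1-t^2)^\alpha\,d(t^2)=2t(1-t^2)^\alpha\,dt,$$ $$\nu_\alpha(r)=\mu_\alpha([0,r]),\qquad \mathsf L_{\alpha,\beta}(f,r)=\frac{1}{\nu_\alpha(r)}\int_0^r\Phi_{L,\beta}(f,t)\,d\mu_\alpha(t)\qquad(0<r<1).$$ Call $f$ exceptional if either $\beta<1$ and $f$ is constant, or $\beta=1$ and $f(z)=a+bz$ for some $a,b\in\mathbb C$ ($b=0$ allowed). Then all the lengths $L(f,t)$ and the integrals above are finite, and $r\mapsto\mathsf L_{\alpha,\beta}(f,r)$ is strictly increasing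 on $(0,1)$ if and only if $f$ is not exceptional. Moreover: (i) $\displaystyle\lim_{r\to0^+}\mathsf L_{\alpha,\beta}(f,r)=0$ when $\beta<1$, and $\displaystyle\lim_{r\to0^+}\mathsf L_{\alpha,\beta}(f,r)=|f'(0)|$ when $\beta=1$. (ii) The finite limit $\Phi_{L,\beta}(f,0):=\lim_{r\to0^+}\Phi_{L,\beta}(f,r)$ exists. If moreover $\Phi_{L,\beta}(f,1):=\lim_{r\to1^-}\Phi_{L,\beta}(f,r)$ is finite, then for all $0<r<s<1$ $$0\le\frac{\mathsf L_{\alpha,\beta}(f,s)-\mathsf L_{\alpha,\beta}(f,r)}{\log\nu_\alpha(s)-\log\nu_\alpha(r)}\le\Phi_{L,\beta}(f,s)-\Phi_{L,\beta}(f,0),$$ and equality holds in either one of these two inequalities if and only if $f$ is exceptional. In particular, in that case $t\mapsto\mathsf L_{\alpha,\beta}(f,t)$ is Lipschitz with respect to $\log\nu_\alpha(t)$ on $(0,1)$: there is a constant $C\ge 0$ with $|\mathsf L_{\alpha,\beta}(f,s)-\mathsf L_{\alpha,\beta}(f,r)|\le C\,|\log\nu_\alpha(s)-\log\nu_\alpha(r)|$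 for all $r,s\in(0,1)$. -/

import Mathlib

open Set Filter Topology MeasureTheory

/-- `f` is a univalent function on the open unit disc: holomorphic and injective there. -/
def UnivalentOnDisc (f : ℂ → ℂ) : Prop :=
  DifferentiableOn ℂ f (Metric.ball (0 : ℂ) 1) ∧ InjOn f (Metric.ball (0 : ℂ) 1)

/-- On the unit disc, `f(z) = a₀ + aₙ zⁿ` for some `n ≥ 1` (the coefficients may vanish). -/
def MonomialOnDisc (f : ℂ → ℂ) : Prop :=
  ∃ (a₀ aₙ : ℂ) (n : ℕ), 1 ≤ n ∧ ∀ z ∈ Metric.ball (0 : ℂ) 1, f z = a₀ + aₙ * z ^ n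

/-- The boundary `∂ f(r𝔻)` of the image (as a point set in the plane) of the disc `r𝔻`. -/
def imageBoundary (f : ℂ → ℂ) (r : ℝ) : Set ℂ :=
  frontier (f '' Metric.ball (0 : ℂ) r)

/-- `L(f, r)`: the Euclidean length, that is the one-dimensional Hausdorff measure, of
`∂ f(r𝔻)`. (In dimension one, Mathlib's normalization gives a segment its usual length.) -/
noncomputable def boundaryLength (f : ℂ → ℂ) (r : ℝ) : ℝ :=
  (Measure.hausdorffMeasure 1 (imageBoundary f r)).toReal

/-- The mixed length `Φ_{L,β}(f, t) = L(f, t) / (2πt)^β`. -/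
noncomputable def mixedLength (β : ℝ) (f : ℂ → ℂ) (t : ℝ) : ℝ :=
  boundaryLength f t / (2 * Real.pi * t) ^ β

/-- The density of `dμ_α(t) = (1 - t²)^α d(t²) = (1 - t²)^α 2t dt` on `(0, 1)`. -/
noncomputable def discWeight (α : ℝ) (t : ℝ) : ℝ :=
  (1 - t ^ 2) ^ α * (2 * t)

/-- `ν_α(r) = μ_α([0, r])`. -/
noncomputable def discNu (α : ℝ) (r : ℝ) : ℝ :=
  ∫ t in (0 : ℝ)..r, discWeight α t

/-- `𝖫_{α,β}(f, r)`: the mean of `Φ_{L,β}(f, ·)` over `(0, r)` with respect to `μ_α`. -/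
noncomputable def meanMixedLength (α β : ℝ) (f : ℂ → ℂ) (r : ℝ) : ℝ :=
  (∫ t in (0 : ℝ)..r, mixedLength β f t * discWeight α t) / discNu α r

/-- The exceptional maps: the constants when `β < 1`, and the maps `z ↦ a + b z`
(with `b = 0` allowed) when `β = 1`. -/
def ExceptionalMap (β : ℝ) (f : ℂ → ℂ) : Prop :=
  (β < 1 ∧ ∃ a : ℂ, ∀ z ∈ Metric.ball (0 : ℂ) 1, f z = a) ∨
  (β = 1 ∧ ∃ a b : ℂ, ∀ z ∈ Metric.ball (0 : ℂ) 1, f z = a + b * z)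

/-! Everything reduces to the monotonicity of `Φ = mixedLength β f`. For univalent `f` the boundary
of `f(t𝔻)` is the injective `C¹` curve `f(|z| = t)`, so its length is `2πt M(t)` with `M(t)` the
circle mean of `|f'|`, and `Φ(t) = (2πt)^(1-β) M(t)`. Since `f'` has no zeros on the disc, `f' =
g²`, and Parseval gives `M(t) = ∑ |gₙ|² t^(2n)`: nondecreasing, strictly so unless `f'` is constant.
For `f = a₀ + a zⁿ` the image is a disc and `Φ(t)` is a constant times `t^(n-β)`. Thus `Φ` is
strictly increasing unless `f` is exceptional, and then it is constant.

The rest concerns weighted means `m` of a nonnegative nondecreasing `Φ`. From `(m(s) - m(r)) ν(s) =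
∫_r^s (Φ - m(r)) dμ` and `Φ(r) ≤ Φ ≤ Φ(s)` on `(r, s)`, the increment of `m` lies between `(Φ(r) -
m(r)) q` and `(Φ(s) - m(r)) q`, where `q = 1 - ν(r)/ν(s)`. Now `Φ(0) ≤ m(r) ≤ Φ(r)`, and `q < log
ν(s) - log ν(r)`. No differentiation in `r` is needed, and the last inequality, being strict,
settles the equality case of the upper bound. -/

section CurveLength

/-! ### Length of injective `C¹` curves -/

variable {E : Type*} [NormedAddCommGroup E] [NormedSpace ℝ E] [MeasurableSpace E] [BorelSpace E]

lemma hausdorffMeasure_image_le_of_norm_sub_le {γ : ℝ → E} {v : E} {S : Set ℝ} {ε : ℝ}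
    (hε : 0 ≤ ε) (h : ∀ x ∈ S, ∀ y ∈ S, ‖γ x - γ y - (x - y) • v‖ ≤ ε * ‖x - y‖) :
    Measure.hausdorffMeasure 1 (γ '' S) ≤ ENNReal.ofReal (‖v‖ + ε) * volume S := by
  have hL : LipschitzOnWith (Real.toNNReal (‖v‖ + ε)) γ S := by
    refine LipschitzOnWith.of_dist_le_mul fun x hx y hy => ?_
    rw [Real.coe_toNNReal _ (by positivity), dist_eq_norm, dist_eq_norm]
    have h1 := norm_add_le (γ x - γ y - (x - y) • v) ((x - y) • v)
    rw [sub_add_cancel, norm_smul] at h1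
    linarith [h x hx y hy]
  have := hL.hausdorffMeasure_image_le (d := 1) zero_le_one
  rwa [ENNReal.rpow_one, hausdorffMeasure_real] at this

/-- Near-linearity makes `γ` expand distances by at least `‖v‖ - ε`, so its inverse is Lipschitz. If
`‖v‖ ≤ ε` the bound is trivial, hence zeros of the velocity need no separate treatment. -/
lemma le_hausdorffMeasure_image_of_norm_sub_le {γ : ℝ → E} {v : E} {S : Set ℝ} {ε : ℝ}
    (h : ∀ x ∈ S, ∀ y ∈ S, ‖γ x - γ y - (x - y) • v‖ ≤ ε * ‖x - y‖) :
    ENNReal.ofReal (‖v‖ - ε) * volume S ≤ Measure.hausdorffMeasure 1 (γ '' S) := by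
  rcases le_or_gt (‖v‖ - ε) 0 with h0 | h0
  · simp [ENNReal.ofReal_of_nonpos h0]
  have hexp : ∀ x ∈ S, ∀ y ∈ S, (‖v‖ - ε) * ‖x - y‖ ≤ ‖γ x - γ y‖ := by
    intro x hx y hy
    have h1 := norm_sub_norm_le ((x - y) • v) ((x - y) • v - (γ x - γ y))
    rw [sub_sub_cancel, norm_smul, norm_sub_rev _ (γ x - γ y)] at h1
    linarith [h x hx y hy]
  have hinj : InjOn γ S := by
    intro x hx y hy hxy
    have h1 := hexp x hx y hy
    rw [hxy, sub_self, norm_zero] at h1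
    have h2 : ‖x - y‖ ≤ 0 := by
      by_contra! h3
      nlinarith [mul_pos h0 h3]
    exact sub_eq_zero.1 (norm_le_zero_iff.1 h2)
  have hinv := hinj.leftInvOn_invFunOn
  have hL : LipschitzOnWith (Real.toNNReal (‖v‖ - ε)⁻¹) (Function.invFunOn γ S) (γ '' S) := by
    refine LipschitzOnWith.of_dist_le_mul ?_
    rintro _ ⟨x, hx, rfl⟩ _ ⟨y, hy, rfl⟩
    rw [Real.coe_toNNReal _ (by positivity), dist_eq_norm, dist_eq_norm, hinv hx, hinv hy,
      ← div_eq_inv_mul, le_div_iff₀ h0, mul_comm]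
    exact hexp x hx y hy
  have := hL.hausdorffMeasure_image_le (d := 1) zero_le_one
  rw [ENNReal.rpow_one, hausdorffMeasure_real, hinv.image_image] at this
  change _ ≤ ENNReal.ofReal _ * _ at this
  calc ENNReal.ofReal (‖v‖ - ε) * volume S
      ≤ ENNReal.ofReal (‖v‖ - ε) *
        (ENNReal.ofReal (‖v‖ - ε)⁻¹ * Measure.hausdorffMeasure 1 (γ '' S)) := by gcongr
    _ = Measure.hausdorffMeasure 1 (γ '' S) := by
      rw [← mul_assoc, ← ENNReal.ofReal_mul h0.le, mul_inv_cancel₀ h0.ne', ENNReal.ofReal_one,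
        one_mul]

/-- The one-dimensional Hausdorff measure of an injective `C¹` curve is its length. -/
theorem hausdorffMeasure_image_Ioc_of_hasDerivAt {γ γ' : ℝ → E} {a b : ℝ} (hab : a ≤ b)
    (hγ : ∀ x, HasDerivAt γ (γ' x) x) (hγ' : Continuous γ') (hinj : InjOn γ (Ioc a b)) :
    Measure.hausdorffMeasure 1 (γ '' Ioc a b) = ENNReal.ofReal (∫ x in a..b, ‖γ' x‖) := by
  have hcont : Continuous γ := continuous_iff_continuousAt.2 fun x => (hγ x).continuousAt
  obtain ⟨K, hK⟩ := (isCompact_Icc (a := a) (b := b)).exists_bound_of_continuousOn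
    hγ'.continuousOn
  have hK0 : 0 ≤ K := (norm_nonneg _).trans (hK a (left_mem_Icc.2 hab))
  set m : ℝ → ℝ → ENNReal := fun s t => Measure.hausdorffMeasure 1 (γ '' Ioc s t) with hm
  have hm_le : ∀ s ∈ Icc a b, ∀ t ∈ Icc a b, m s t ≤ ENNReal.ofReal (K * (t - s)) := by
    intro s hs t ht
    have := hausdorffMeasure_image_le_of_norm_sub_le (γ := γ) (v := 0) (S := Ioc s t) hK0
      fun x hx y hy => by
        rw [smul_zero, sub_zero]
        exact (convex_Icc a b).norm_image_sub_le_of_norm_hasDerivWithin_le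
          (fun z _ => (hγ z).hasDerivWithinAt) hK
          ⟨hs.1.trans hy.1.le, hy.2.trans ht.2⟩ ⟨hs.1.trans hx.1.le, hx.2.trans ht.2⟩
    rwa [norm_zero, zero_add, Real.volume_Ioc, ← ENNReal.ofReal_mul hK0] at this
  have hm_fin : ∀ s ∈ Icc a b, ∀ t ∈ Icc a b, m s t ≠ ⊤ := fun s hs t ht =>
    ne_top_of_le_ne_top ENNReal.ofReal_ne_top (hm_le s hs t ht)
  have hadd : ∀ s ∈ Icc a b, ∀ t ∈ Icc a b, s ≤ t → m a t = m a s + m s t := by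
    intro s hs t ht hst
    have hsub : Ioc s t ⊆ Ioc a b := Ioc_subset_Ioc hs.1 ht.2
    -- The half-open arc is a compact arc with at most one point removed.
    have hmeas : MeasurableSet (γ '' Ioc s t) := by
      have h1 : γ '' Ioc s t = γ '' Icc s t \ ({γ s} \ γ '' Ioc s t) := by
        rw [← Ioc_insert_left hst, image_insert_eq]
        ext z
        simp only [Set.mem_sdiff, mem_insert_iff, mem_singleton_iff]
        tauto
      rw [h1]
      refine (isCompact_Icc.image hcont).measurableSet.diff ?_
      exact (Set.Subsingleton.anti subsingleton_singleton sdiff_subset).measurableSet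
    rw [hm]
    simp only
    rw [← Ioc_union_Ioc_eq_Ioc hs.1 hst, image_union, measure_union _ hmeas]
    refine disjoint_image_image fun x hx y hy hxy => ?_
    have := hinj ⟨hx.1, hx.2.trans hs.2⟩ (hsub hy) hxy
    exact absurd hx.2 (not_le.2 (this ▸ hy.1))
  have hsubF : ∀ s ∈ Icc a b, ∀ t ∈ Icc a b, s ≤ t →
      (m a t).toReal - (m a s).toReal = (m s t).toReal := by
    intro s hs t ht hst
    have ha : a ∈ Icc a b := left_mem_Icc.2 hab
    rw [hadd s hs t ht hst, ENNReal.toReal_add (hm_fin a ha s hs) (hm_fin s hs t ht)]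
    ring
  have hFcont : ContinuousOn (fun t => (m a t).toReal) (Icc a b) := by
    have hle : ∀ s ∈ Icc a b, ∀ t ∈ Icc a b, s ≤ t →
        dist (m a s).toReal (m a t).toReal ≤ K * dist s t := by
      intro s hs t ht hst
      rw [dist_comm, Real.dist_eq, hsubF s hs t ht hst, abs_of_nonneg ENNReal.toReal_nonneg,
        dist_comm, Real.dist_eq, abs_of_nonneg (sub_nonneg.2 hst)]
      exact ENNReal.toReal_le_of_le_ofReal (mul_nonneg hK0 (sub_nonneg.2 hst)) (hm_le s hs t ht)
    have : LipschitzOnWith (Real.toNNReal K) (fun t => (m a t).toReal) (Icc a b) := by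
      refine LipschitzOnWith.of_dist_le_mul fun s hs t ht => ?_
      rw [Real.coe_toNNReal _ hK0]
      rcases le_total s t with h | h
      · exact hle s hs t ht h
      · rw [dist_comm, dist_comm s]
        exact hle t ht s hs h
    exact this.continuousOn
  -- Strict differentiability at `s` makes `γ` nearly linear on a short interval, and the two bounds
  -- above pinch the measure of the arc to `(‖γ' s‖ ± ε)(t - s)`.
  have hFderiv : ∀ s ∈ Ico a b,
      HasDerivWithinAt (fun t => (m a t).toReal) ‖γ' s‖ (Ici s) s := by
    intro s hs
    have hs' : s ∈ Icc a b := ⟨hs.1, hs.2.le⟩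
    have hstrict : HasStrictDerivAt γ (γ' s) s :=
      hasStrictDerivAt_of_hasDerivAt_of_continuousAt (Eventually.of_forall hγ) hγ'.continuousAt
    rw [hasDerivWithinAt_iff_isLittleO, Asymptotics.isLittleO_iff]
    intro ε hε
    have h1 := hstrict.hasStrictFDerivAt.isLittleO.def hε
    obtain ⟨δ, hδ, hball⟩ := Metric.eventually_nhds_iff_ball.1 h1
    have h2 : Ico s (min (s + δ) b) ∈ 𝓝[≥] s :=
      Ico_mem_nhdsGE (lt_min (by linarith) hs.2)
    filter_upwards [h2] with t ht
    have ht' : t ∈ Icc a b := ⟨hs.1.trans ht.1, (ht.2.trans_le (min_le_right _ _)).le⟩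
    have htδ : t < s + δ := ht.2.trans_le (min_le_left _ _)
    have hest : ∀ x ∈ Ioc s t, ∀ y ∈ Ioc s t,
        ‖γ x - γ y - (x - y) • γ' s‖ ≤ ε * ‖x - y‖ := by
      intro x hx y hy
      refine hball (x, y) ?_
      rw [← ball_prod_same, mem_prod, Metric.mem_ball, Metric.mem_ball, Real.dist_eq,
        Real.dist_eq, abs_lt, abs_lt]
      exact ⟨⟨by linarith [hx.1], by linarith [hx.2]⟩, ⟨by linarith [hy.1], by linarith [hy.2]⟩⟩
    have hup := hausdorffMeasure_image_le_of_norm_sub_le hε.le hest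
    have hlo := le_hausdorffMeasure_image_of_norm_sub_le hest
    have hts : 0 ≤ t - s := sub_nonneg.2 ht.1
    rw [Real.volume_Ioc, ← ENNReal.ofReal_mul' hts] at hup hlo
    have hup' : (m s t).toReal ≤ (‖γ' s‖ + ε) * (t - s) :=
      ENNReal.toReal_le_of_le_ofReal (by positivity) hup
    have hlo' : (‖γ' s‖ - ε) * (t - s) ≤ (m s t).toReal :=
      (ENNReal.ofReal_le_iff_le_toReal (hm_fin s hs' t ht')).1 hlo
    rw [hsubF s hs' t ht' ht.1, Real.norm_eq_abs, Real.norm_of_nonneg hts, smul_eq_mul, abs_le]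
    constructor <;> nlinarith
  have hnc : Continuous fun x => ‖γ' x‖ := hγ'.norm
  have hI : ∀ s, HasDerivAt (fun u => ∫ x in a..u, ‖γ' x‖) ‖γ' s‖ s := fun s =>
    intervalIntegral.integral_hasDerivAt_right (hnc.intervalIntegrable _ _)
      hnc.stronglyMeasurable.stronglyMeasurableAtFilter hnc.continuousAt
  have hconst := constant_of_has_deriv_right_zero
    (f := fun t => (m a t).toReal - ∫ x in a..t, ‖γ' x‖) (a := a) (b := b)
    (hFcont.sub fun s _ => (hI s).continuousAt.continuousWithinAt)
    (fun s hs => by simpa using! (hFderiv s hs).sub (hI s).hasDerivWithinAt)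
    b (right_mem_Icc.2 hab)
  have hb : (m a b).toReal = ∫ x in a..b, ‖γ' x‖ := by
    have : m a a = 0 := by simp [hm]
    simp only [this, intervalIntegral.integral_same, ENNReal.toReal_zero, sub_self] at hconst
    linarith
  rw [← hb, ENNReal.ofReal_toReal (hm_fin a (left_mem_Icc.2 hab) b (right_mem_Icc.2 hab))]

end CurveLength

/-! ### Nonvanishing of the derivative of a univalent function -/

/-- The derivative of an injective holomorphic function does not vanish. -/
theorem deriv_ne_zero_of_injOn {f : ℂ → ℂ} {U : Set ℂ} (hU : IsOpen U)
    (hf : DifferentiableOn ℂ f U) (hinj : InjOn f U) {z : ℂ} (hz : z ∈ U) : deriv f z ≠ 0 := by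
  have hnc : ∀ w ∈ U, ¬ ∀ᶠ y in 𝓝 w, f y = f w := by
    intro w hw h
    have h1 : ∀ᶠ y in 𝓝[≠] w, False := by
      filter_upwards [h.filter_mono nhdsWithin_le_nhds, self_mem_nhdsWithin,
        nhdsWithin_le_nhds (hU.mem_nhds hw)] with y hy hne hyU
      exact hne (hinj hyU hw hy)
    simp [NeBot.ne] at h1
  have hana : ∀ w ∈ U, AnalyticAt ℂ f w := fun w hw => hf.analyticAt (hU.mem_nhds hw)
  have hopen : ∀ w ∈ U, 𝓝 (f w) ≤ map f (𝓝 w) := fun w hw =>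
    (hana w hw).eventually_constant_or_nhds_le_map_nhds.resolve_left (hnc w hw)
  set g := Function.invFunOn f U with hg
  have hgf : LeftInvOn g f U := hinj.leftInvOn_invFunOn
  have hgcont : ∀ w ∈ U, ContinuousAt g (f w) := by
    intro w hw
    have h1 : Tendsto (g ∘ f) (𝓝 w) (𝓝 w) :=
      tendsto_id.congr' (by filter_upwards [hU.mem_nhds hw] with y hy using (hgf hy).symm)
    rw [ContinuousAt, hgf hw]
    exact (tendsto_map'_iff.2 h1).mono_left (hopen w hw)
  have hgd : ∀ w ∈ U, deriv f w ≠ 0 → DifferentiableAt ℂ g (f w) := by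
    intro w hw h0
    refine (HasDerivAt.of_local_left_inverse (f := f) (hgcont w hw) ?_ h0 ?_).differentiableAt
    · rw [hgf hw]
      exact (hana w hw).differentiableAt.hasDerivAt
    · filter_upwards [hopen w hw (image_mem_map (hU.mem_nhds hw))] with y hy
      exact Function.invFunOn_eq hy
  have hd : ∀ᶠ w in 𝓝[≠] z, deriv f w ≠ 0 := by
    refine ((hana z hz).deriv.eventually_eq_or_eventually_ne
      (analyticAt_const (v := (0 : ℂ)))).resolve_left fun h => hnc z hz ?_
    obtain ⟨ε, hε, hball⟩ := Metric.eventually_nhds_iff_ball.1 (h.and (hU.mem_nhds hz))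
    filter_upwards [Metric.ball_mem_nhds z hε] with y hy
    refine Metric.isOpen_ball.is_const_of_deriv_eq_zero (convex_ball z ε).isPreconnected
      (hf.mono fun w hw => (hball w hw).2) (fun w hw => (hball w hw).1) hy
      (Metric.mem_ball_self hε)
  -- Zeros of `f'` are isolated, so the continuous inverse `g` is holomorphic on a punctured
  -- neighbourhood of `f z`. The singularity is removable, and the chain rule gives `g' f' = 1` at
  -- `z` too.
  have hgz : DifferentiableAt ℂ g (f z) := by
    refine (Complex.analyticAt_of_differentiable_on_punctured_nhds_of_continuousAt ?_
      (hgcont z hz)).differentiableAt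
    rw [eventually_nhdsWithin_iff] at hd ⊢
    filter_upwards [hopen z hz (image_mem_map (hd.and (hU.mem_nhds hz)))]
    rintro _ ⟨y, ⟨hy, hyU⟩, rfl⟩ hne
    exact hgd y hyU (hy fun h => hne (by rw [mem_singleton_iff] at h ⊢; rw [h]))
  have h1 : HasDerivAt (g ∘ f) (deriv g (f z) * deriv f z) z :=
    hgz.hasDerivAt.comp z (hana z hz).differentiableAt.hasDerivAt
  have h2 : HasDerivAt (g ∘ f) 1 z := (hasDerivAt_id z).congr_of_eventuallyEq
    (by filter_upwards [hU.mem_nhds hz] with y hy using hgf hy)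
  intro h0
  rw [h0, mul_zero] at h1
  exact zero_ne_one (h1.unique h2)

/-! ### Square roots, Parseval and quadratic circle means -/

/-- A nonvanishing holomorphic function on a disc has a holomorphic square root. -/
lemma exists_sq_eq_of_differentiableOn_ball {f : ℂ → ℂ} {c : ℂ} {r : ℝ}
    (hf : DifferentiableOn ℂ f (Metric.ball c r)) (h0 : ∀ z ∈ Metric.ball c r, f z ≠ 0) :
    ∃ g : ℂ → ℂ, DifferentiableOn ℂ g (Metric.ball c r) ∧ ∀ z ∈ Metric.ball c r, g z ^ 2 = f z := by
  rcases le_or_gt r 0 with hr | hr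
  · simp only [Metric.ball_eq_empty.2 hr]
    exact ⟨0, differentiableOn_empty, by simp⟩
  have := Metric.contractibleSpace_ball (x := c) hr
  have hsc : IsSimplyConnected (Metric.ball c r) := SimplyConnectedSpace.ofContractible _
  obtain ⟨g, hgc, hg⟩ := Complex.exists_continuousOn_pow_eq hsc Metric.isOpen_ball hf.continuousOn
    (by rintro ⟨z, hz, h⟩; exact h0 z hz h) two_ne_zero
  refine ⟨g, fun z hz => ?_, fun z _ => hg z⟩
  have hgz : g z ≠ 0 := fun h => h0 z hz (by rw [← hg z, h, zero_pow two_ne_zero])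
  have hgcz := hgc.continuousAt (Metric.isOpen_ball.mem_nhds hz)
  have hfz := (hf.differentiableAt (Metric.isOpen_ball.mem_nhds hz)).hasDerivAt
  exact (HasDerivAt.of_comp_left (f := fun w => w ^ 2) hgcz (by simpa using hasDerivAt_pow 2 (g z))
    hfz (mul_ne_zero two_ne_zero hgz)
    (Eventually.of_forall hg)).differentiableAt.differentiableWithinAt

/-- The period is left as `2π - 0` because `fourierCoeffOn` on `[a, b]` uses the circle of length `b
- a`. -/
lemma fourier_two_pi_sub_zero_apply (n : ℤ) (θ : ℝ) :
    fourier n (θ : AddCircle (2 * Real.pi - 0)) = Complex.exp (θ * Complex.I) ^ n := by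
  have : (Real.pi : ℂ) ≠ 0 := by exact_mod_cast Real.pi_ne_zero
  rw [fourier_coe_apply, ← Complex.exp_int_mul]
  congr 1
  push_cast
  field_simp
  ring

/-- Parseval's identity for a holomorphic function on a disc. -/
theorem hasSum_circleAverage_norm_sq {g : ℂ → ℂ} {R t : ℝ}
    (hg : DifferentiableOn ℂ g (Metric.ball 0 R)) (ht0 : 0 < t) (htR : t < R) :
    HasSum (fun n : ℕ => (t ^ n * (‖iteratedDeriv n g 0‖ / n.factorial)) ^ 2)
      (Real.circleAverage (fun z => ‖g z‖ ^ 2) 0 t) := by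
  have hcl : DifferentiableOn ℂ g (Metric.closedBall 0 t) :=
    hg.mono (Metric.closedBall_subset_ball htR)
  have htne : (t : ℂ) ≠ 0 := by exact_mod_cast ht0.ne'
  have hcont : Continuous fun θ => g (circleMap 0 t θ) :=
    hcl.continuousOn.comp_continuous (continuous_circleMap 0 t)
      fun θ => circleMap_mem_closedBall 0 ht0.le θ
  have hL2 : MemLp (fun θ => g (circleMap 0 t θ)) 2 (volume.restrict (Ioc 0 (2 * Real.pi))) := by
    obtain ⟨C, hC⟩ := (isCompact_closedBall (0 : ℂ) t).exists_bound_of_continuousOn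
      hcl.continuousOn
    exact MemLp.of_bound hcont.aestronglyMeasurable C
      (Eventually.of_forall fun θ => hC _ (circleMap_mem_closedBall 0 ht0.le θ))
  have hsum := hasSum_sq_fourierCoeffOn Real.two_pi_pos hL2
  have hval : ((2 * Real.pi - 0)⁻¹ • ∫ θ in (0 : ℝ)..2 * Real.pi, ‖g (circleMap 0 t θ)‖ ^ 2) =
      Real.circleAverage (fun z => ‖g z‖ ^ 2) 0 t := by
    rw [sub_zero, Real.circleAverage_def]
  rw [hval] at hsum
  -- Negative frequencies amount to integrating `z^m g(z)` over the circle, which vanishes by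
  -- Cauchy's theorem.
  have hneg : ∀ m : ℕ, fourierCoeffOn Real.two_pi_pos (fun θ => g (circleMap 0 t θ))
      (-(m + 1 : ℕ) : ℤ) = 0 := by
    intro m
    have h0 : ∮ z in C(0, t), z ^ m * g z = 0 := by
      refine DiffContOnCl.circleIntegral_eq_zero ht0.le ?_
      refine DifferentiableOn.diffContOnCl ?_
      rw [closure_ball _ ht0.ne']
      fun_prop
    rw [circleIntegral] at h0
    rw [fourierCoeffOn_eq_integral]
    have : ∀ θ : ℝ, (fourier (-(-(m + 1 : ℕ) : ℤ)) (θ : AddCircle (2 * Real.pi - 0)) : ℂ) •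
        g (circleMap 0 t θ) = (Complex.I * t ^ (m + 1))⁻¹ *
          (deriv (circleMap 0 t) θ • (circleMap 0 t θ ^ m * g (circleMap 0 t θ))) := by
      intro θ
      rw [fourier_two_pi_sub_zero_apply, neg_neg, zpow_natCast, deriv_circleMap, circleMap_zero,
        smul_eq_mul, smul_eq_mul, mul_pow]
      have := Complex.I_ne_zero
      field_simp
      ring
    simp_rw [this]
    rw [intervalIntegral.integral_const_mul, h0, mul_zero, smul_zero]
  have hnat : ∀ n : ℕ, fourierCoeffOn Real.two_pi_pos (fun θ => g (circleMap 0 t θ)) (n : ℤ) =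
      t ^ n * (iteratedDeriv n g 0 / n.factorial) := by
    intro n
    have h0 := DifferentiableOn.circleIntegral_one_div_sub_center_pow_smul ht0 n hcl
    rw [circleIntegral] at h0
    rw [fourierCoeffOn_eq_integral]
    have : ∀ θ : ℝ, (fourier (-(n : ℤ)) (θ : AddCircle (2 * Real.pi - 0)) : ℂ) •
        g (circleMap 0 t θ) = (t ^ n / Complex.I) * (deriv (circleMap 0 t) θ •
          (1 / (circleMap 0 t θ - 0) ^ (n + 1)) • g (circleMap 0 t θ)) := by
      intro θ
      rw [fourier_two_pi_sub_zero_apply, zpow_neg, zpow_natCast, deriv_circleMap, circleMap_zero,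
        smul_eq_mul, smul_eq_mul, smul_eq_mul, sub_zero, mul_pow]
      have := Complex.I_ne_zero
      have := Complex.exp_ne_zero (θ * Complex.I)
      field_simp
      ring
    simp_rw [this]
    rw [intervalIntegral.integral_const_mul, h0, Complex.real_smul, smul_eq_mul]
    have : (Real.pi : ℂ) ≠ 0 := by exact_mod_cast Real.pi_ne_zero
    have := Complex.I_ne_zero
    push_cast
    field_simp
    ring
  rw [← Nat.cast_injective (R := ℤ) |>.hasSum_iff] at hsum
  · convert! hsum using 2 with n
    rw [Function.comp_apply, hnat, norm_mul, norm_div, norm_pow, Complex.norm_real,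
      Real.norm_of_nonneg ht0.le, Complex.norm_natCast]
  · intro i hi
    obtain ⟨m, rfl⟩ : ∃ m : ℕ, i = -((m + 1 : ℕ) : ℤ) := by
      rcases i with n | m
      · exact absurd ⟨n, rfl⟩ hi
      · exact ⟨m, rfl⟩
    rw [hneg]
    simp

/-- A nonconstant `g` has a nonzero Taylor coefficient of positive order, whose Parseval term is
strictly increasing while no term decreases. -/
theorem circleAverage_norm_sq_strictMonoOn {g : ℂ → ℂ} {R : ℝ}
    (hg : DifferentiableOn ℂ g (Metric.ball 0 R))
    (hne : ¬ ∃ c, ∀ z ∈ Metric.ball (0 : ℂ) R, g z = c) :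
    StrictMonoOn (Real.circleAverage (fun z => ‖g z‖ ^ 2) 0) (Ioo 0 R) := by
  obtain ⟨n, hn, hn0⟩ : ∃ n : ℕ, n ≠ 0 ∧ iteratedDeriv n g 0 ≠ 0 := by
    by_contra! h
    refine hne ⟨g 0, fun z hz => ?_⟩
    rw [← Complex.taylorSeries_eq_on_ball hg hz, tsum_eq_single 0]
    · simp
    · intro n hn
      simp [h n hn]
  intro r hr s hs hrs
  have hr0 := hr.1
  refine hasSum_lt (i := n) (fun k => ?_) ?_ (hasSum_circleAverage_norm_sq hg hr.1 hr.2)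
    (hasSum_circleAverage_norm_sq hg hs.1 hs.2)
  · gcongr
  · have : 0 < ‖iteratedDeriv n g 0‖ / n.factorial := by positivity
    gcongr

/-! ### Circle means of `|h|` for zero-free `h` -/

section NonvanishingMean

variable {h : ℂ → ℂ} {R : ℝ}

lemma sq_norm_le_circleAverage_norm_sq {g : ℂ → ℂ} {t : ℝ}
    (hg : DifferentiableOn ℂ g (Metric.ball 0 R)) (ht : t ∈ Ioo 0 R) :
    ‖g 0‖ ^ 2 ≤ Real.circleAverage (fun z => ‖g z‖ ^ 2) 0 t := by
  have h0 := le_hasSum (hasSum_circleAverage_norm_sq hg ht.1 ht.2) 0 fun n _ => sq_nonneg _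
  simpa using h0

/-- With `h = g²` the mean of `|h|` becomes a mean of `|g|²`, to which Parseval applies. -/
lemma exists_norm_eq_sq_norm (hh : DifferentiableOn ℂ h (Metric.ball 0 R))
    (h0 : ∀ z ∈ Metric.ball 0 R, h z ≠ 0) :
    ∃ g : ℂ → ℂ, DifferentiableOn ℂ g (Metric.ball 0 R) ∧
      (∀ z ∈ Metric.ball 0 R, g z ^ 2 = h z) ∧
      ∀ t ∈ Ioo 0 R, Real.circleAverage (fun z => ‖h z‖) 0 t =
        Real.circleAverage (fun z => ‖g z‖ ^ 2) 0 t := by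
  obtain ⟨g, hg, hgh⟩ := exists_sq_eq_of_differentiableOn_ball hh h0
  refine ⟨g, hg, hgh, fun t ht => Real.circleAverage_congr_sphere fun z hz => ?_⟩
  have hz' : z ∈ Metric.ball (0 : ℂ) R := by
    rw [abs_of_pos ht.1, mem_sphere_zero_iff_norm] at hz
    rw [mem_ball_zero_iff, hz]
    exact ht.2
  simp only [← hgh z hz', norm_pow]

lemma norm_le_circleAverage_norm (hh : DifferentiableOn ℂ h (Metric.ball 0 R))
    (h0 : ∀ z ∈ Metric.ball 0 R, h z ≠ 0) {t : ℝ} (ht : t ∈ Ioo 0 R) :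
    ‖h 0‖ ≤ Real.circleAverage (fun z => ‖h z‖) 0 t := by
  obtain ⟨g, hg, hgh, hav⟩ := exists_norm_eq_sq_norm hh h0
  rw [hav t ht, ← hgh 0 (Metric.mem_ball_self (ht.1.trans ht.2)), norm_pow]
  exact sq_norm_le_circleAverage_norm_sq hg ht

theorem circleAverage_norm_strictMonoOn (hh : DifferentiableOn ℂ h (Metric.ball 0 R))
    (h0 : ∀ z ∈ Metric.ball 0 R, h z ≠ 0) (hne : ¬ ∃ c, ∀ z ∈ Metric.ball (0 : ℂ) R, h z = c) :
    StrictMonoOn (Real.circleAverage (fun z => ‖h z‖) 0) (Ioo 0 R) := by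
  obtain ⟨g, hg, hgh, hav⟩ := exists_norm_eq_sq_norm hh h0
  refine (circleAverage_norm_sq_strictMonoOn hg ?_).congr fun t ht => (hav t ht).symm
  rintro ⟨c, hc⟩
  exact hne ⟨c ^ 2, fun z hz => by rw [← hgh z hz, hc z hz]⟩

lemma circleAverage_norm_monotoneOn (hh : DifferentiableOn ℂ h (Metric.ball 0 R))
    (h0 : ∀ z ∈ Metric.ball 0 R, h z ≠ 0) :
    MonotoneOn (Real.circleAverage (fun z => ‖h z‖) 0) (Ioo 0 R) := by
  by_cases hne : ∃ c, ∀ z ∈ Metric.ball (0 : ℂ) R, h z = c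
  · obtain ⟨c, hc⟩ := hne
    have : ∀ t ∈ Ioo 0 R, Real.circleAverage (fun z => ‖h z‖) 0 t = ‖c‖ := by
      intro t ht
      refine Real.circleAverage_const_on_circle fun z hz => ?_
      rw [abs_of_pos ht.1, mem_sphere_zero_iff_norm] at hz
      rw [hc z (by rw [mem_ball_zero_iff, hz]; exact ht.2)]
    intro s hs t ht _
    rw [this s hs, this t ht]
  · exact (circleAverage_norm_strictMonoOn hh h0 hne).monotoneOn

lemma tendsto_circleAverage_norm (hR : 0 < R) (hh : DifferentiableOn ℂ h (Metric.ball 0 R))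
    (h0 : ∀ z ∈ Metric.ball 0 R, h z ≠ 0) :
    Tendsto (Real.circleAverage (fun z => ‖h z‖) 0) (𝓝[>] 0) (𝓝 ‖h 0‖) := by
  have hR' : Ioo 0 R ∈ 𝓝[>] (0 : ℝ) := Ioo_mem_nhdsGT hR
  refine tendsto_order.2 ⟨fun a ha => ?_, fun a ha => ?_⟩
  · filter_upwards [hR'] with t ht
    exact ha.trans_le (norm_le_circleAverage_norm hh h0 ht)
  · obtain ⟨b, hb, hba⟩ := exists_between ha
    have hc : ContinuousAt (fun z => ‖h z‖) 0 :=
      (hh.continuousOn.continuousAt (Metric.ball_mem_nhds 0 hR)).norm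
    obtain ⟨δ, hδ, hball⟩ := Metric.eventually_nhds_iff_ball.1 (hc.eventually_lt_const hb)
    filter_upwards [hR', Ioo_mem_nhdsGT hδ] with t ht htδ
    refine lt_of_le_of_lt (Real.circleAverage_mono_on_of_le_circle ?_ fun z hz => ?_) hba
    · refine ContinuousOn.circleIntegrable ht.1.le (hh.continuousOn.norm.mono ?_)
      exact Metric.sphere_subset_closedBall.trans (Metric.closedBall_subset_ball ht.2)
    · rw [abs_of_pos ht.1, mem_sphere_zero_iff_norm] at hz
      exact (hball z (by rw [mem_ball_zero_iff, hz]; exact htδ.2)).le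

end NonvanishingMean

/-! ### Boundary length for univalent functions -/

section Univalent

variable {f : ℂ → ℂ} {t : ℝ}

/-- The image is open by the open mapping theorem, its closure is the image of the closed disc by
compactness, and injectivity lets the difference pass through `f`. -/
lemma UnivalentOnDisc.imageBoundary_eq (hf : UnivalentOnDisc f) (ht : t ∈ Ioo (0 : ℝ) 1) :
    imageBoundary f t = f '' Metric.sphere 0 t := by
  have hsub : Metric.closedBall (0 : ℂ) t ⊆ Metric.ball 0 1 := Metric.closedBall_subset_ball ht.2
  have hbsub : Metric.ball (0 : ℂ) t ⊆ Metric.ball 0 1 := Metric.ball_subset_ball ht.2.le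
  have hcont := hf.1.continuousOn.mono hsub
  have hopen : IsOpen (f '' Metric.ball 0 t) := by
    refine ((hf.1.analyticOnNhd Metric.isOpen_ball).is_constant_or_isOpen
      (convex_ball (0 : ℂ) 1).isPreconnected).resolve_left ?_ _ hbsub Metric.isOpen_ball
    rintro ⟨w, hw⟩
    have h0 : (0 : ℂ) ∈ Metric.ball (0 : ℂ) 1 := by simp
    have h1 : (2⁻¹ : ℂ) ∈ Metric.ball (0 : ℂ) 1 := by simp; norm_num
    have := hf.2 h0 h1 ((hw _ h0).trans (hw _ h1).symm)
    norm_num at this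
  have hclosure : closure (f '' Metric.ball 0 t) = f '' Metric.closedBall 0 t := by
    refine subset_antisymm (closure_minimal (image_mono Metric.ball_subset_closedBall)
      ((isCompact_closedBall 0 t).image_of_continuousOn hcont).isClosed) ?_
    rw [← closure_ball (0 : ℂ) ht.1.ne'] at hcont ⊢
    exact hcont.image_closure
  rw [imageBoundary, frontier, hclosure, hopen.interior_eq,
    ← (hf.2.mono hsub).image_sdiff_subset Metric.ball_subset_closedBall,
    Metric.closedBall_sdiff_ball]

lemma UnivalentOnDisc.hausdorffMeasure_imageBoundary (hf : UnivalentOnDisc f)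
    (ht : t ∈ Ioo (0 : ℝ) 1) :
    Measure.hausdorffMeasure 1 (imageBoundary f t) =
      ENNReal.ofReal (2 * Real.pi * t * Real.circleAverage (fun z => ‖deriv f z‖) 0 t) := by
  have hmem : ∀ θ, circleMap 0 t θ ∈ Metric.ball (0 : ℂ) 1 := fun θ =>
    Metric.closedBall_subset_ball ht.2 (circleMap_mem_closedBall 0 ht.1.le θ)
  have hd : DifferentiableOn ℂ (deriv f) (Metric.ball 0 1) := hf.1.deriv Metric.isOpen_ball
  have hcurve := hausdorffMeasure_image_Ioc_of_hasDerivAt (γ := fun θ => f (circleMap 0 t θ))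
    (γ' := fun θ => (circleMap 0 t θ * Complex.I) • deriv f (circleMap 0 t θ))
    Real.two_pi_pos.le
    (fun θ => HasDerivAt.scomp θ
      (hf.1.differentiableAt (Metric.isOpen_ball.mem_nhds (hmem θ))).hasDerivAt
      (hasDerivAt_circleMap 0 t θ))
    (((continuous_circleMap 0 t).mul continuous_const).smul
      (hd.continuousOn.comp_continuous (continuous_circleMap 0 t) hmem))
    (hf.2.comp (by
      have := injOn_circleMap_of_abs_sub_le (a := 0) (b := 2 * Real.pi) (c := 0) ht.1.ne'
        (by rw [zero_sub, abs_neg, abs_of_pos Real.two_pi_pos])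
      rwa [uIoc_of_le Real.two_pi_pos.le] at this) fun θ _ => hmem θ)
  rw [hf.imageBoundary_eq ht, ← abs_of_pos ht.1, ← image_circleMap_Ioc, image_image,
    abs_of_pos ht.1, hcurve]
  congr 1
  have : ∀ θ, ‖(circleMap 0 t θ * Complex.I) • deriv f (circleMap 0 t θ)‖ =
      t * ‖deriv f (circleMap 0 t θ)‖ := by
    intro θ
    rw [smul_eq_mul, norm_mul, norm_mul, Complex.norm_I, norm_circleMap_zero, abs_of_pos ht.1,
      mul_one]
  simp_rw [this]
  rw [intervalIntegral.integral_const_mul, Real.circleAverage_def, smul_eq_mul]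
  field_simp

end Univalent

/-! ### Boundary length for `a₀ + a zⁿ` -/

section Monomial

variable {f : ℂ → ℂ} {a₀ a : ℂ} {n : ℕ} {t : ℝ}

lemma hausdorffMeasure_sphere (c : ℂ) {R : ℝ} (hR : 0 < R) :
    Measure.hausdorffMeasure 1 (Metric.sphere c R) = ENNReal.ofReal (2 * Real.pi * R) := by
  have hcurve := hausdorffMeasure_image_Ioc_of_hasDerivAt (γ := circleMap c R)
    (γ' := fun θ => circleMap 0 R θ * Complex.I) Real.two_pi_pos.le
    (fun θ => hasDerivAt_circleMap c R θ)
    ((continuous_circleMap 0 R).mul continuous_const) (by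
      have := injOn_circleMap_of_abs_sub_le (a := 0) (b := 2 * Real.pi) (c := c) hR.ne'
        (by rw [zero_sub, abs_neg, abs_of_pos Real.two_pi_pos])
      rwa [uIoc_of_le Real.two_pi_pos.le] at this)
  rw [image_circleMap_Ioc, abs_of_pos hR] at hcurve
  simp [hcurve, abs_of_pos hR]

/-- Existence of `n`-th roots gives surjectivity. As a point set the boundary circle counts once, so
its length carries no factor `n`. -/
lemma image_ball_of_eq_add_mul_pow (hn : 1 ≤ n) (ha : a ≠ 0)
    (hf : ∀ z ∈ Metric.ball (0 : ℂ) 1, f z = a₀ + a * z ^ n) (ht : t ∈ Ioo (0 : ℝ) 1) :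
    f '' Metric.ball 0 t = Metric.ball a₀ (‖a‖ * t ^ n) := by
  have ha' : 0 < ‖a‖ := norm_pos_iff.2 ha
  have hn0 : n ≠ 0 := by omega
  ext w
  rw [mem_ball_iff_norm]
  constructor
  · rintro ⟨z, hz, rfl⟩
    rw [hf z (Metric.ball_subset_ball ht.2.le hz), add_sub_cancel_left, norm_mul, norm_pow]
    rw [mem_ball_zero_iff] at hz
    gcongr
  · intro hw
    obtain ⟨z, hz⟩ := IsAlgClosed.exists_pow_nat_eq ((w - a₀) / a) (Nat.pos_of_ne_zero hn0)
    have hzt : z ∈ Metric.ball (0 : ℂ) t := by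
      rw [mem_ball_zero_iff]
      refine lt_of_pow_lt_pow_left₀ n ht.1.le ?_
      rw [← norm_pow, hz, norm_div, div_lt_iff₀ ha', mul_comm]
      exact hw
    refine ⟨z, hzt, ?_⟩
    rw [hf z (Metric.ball_subset_ball ht.2.le hzt), hz]
    field_simp
    ring

lemma hausdorffMeasure_imageBoundary_of_eq_add_mul_pow (hn : 1 ≤ n)
    (hf : ∀ z ∈ Metric.ball (0 : ℂ) 1, f z = a₀ + a * z ^ n) (ht : t ∈ Ioo (0 : ℝ) 1) :
    Measure.hausdorffMeasure 1 (imageBoundary f t) =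
      ENNReal.ofReal (2 * Real.pi * (‖a‖ * t ^ n)) := by
  rw [imageBoundary]
  by_cases ha : a = 0
  · have himg : f '' Metric.ball 0 t = {a₀} := by
      have hne : (Metric.ball (0 : ℂ) t).Nonempty := Metric.nonempty_ball.2 ht.1
      rw [← hne.image_const a₀]
      refine image_congr fun z hz => ?_
      rw [hf z (Metric.ball_subset_ball ht.2.le hz), ha, zero_mul, add_zero]
    have := Measure.nullSingletonClass_hausdorff ℂ one_pos
    rw [himg, isClosed_singleton.frontier_eq]
    refine (measure_mono_null Set.sdiff_subset (measure_singleton a₀)).trans ?_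
    simp [ha]
  · have h0 : 0 < ‖a‖ * t ^ n := mul_pos (norm_pos_iff.2 ha) (pow_pos ht.1 n)
    rw [image_ball_of_eq_add_mul_pow hn ha hf ht, frontier_ball _ h0.ne',
      hausdorffMeasure_sphere _ h0]

lemma deriv_zero_of_eq_add_mul_pow (hf : ∀ z ∈ Metric.ball (0 : ℂ) 1, f z = a₀ + a * z ^ n) :
    deriv f 0 = a * (n * 0 ^ (n - 1)) := by
  have : f =ᶠ[𝓝 0] fun z => a₀ + a * z ^ n := by
    filter_upwards [Metric.ball_mem_nhds (0 : ℂ) one_pos] with z hz using hf z hz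
  rw [this.deriv_eq]
  simp

end Monomial

/-! ### Monotonicity and limit of the mixed length -/

section MixedLength

variable {f : ℂ → ℂ} {β t : ℝ}

lemma hausdorffMeasure_imageBoundary_lt_top (hf : UnivalentOnDisc f ∨ MonomialOnDisc f)
    (ht : t ∈ Ioo (0 : ℝ) 1) : Measure.hausdorffMeasure 1 (imageBoundary f t) < ⊤ := by
  rcases hf with hf | ⟨a₀, a, n, hn, hf⟩
  · rw [hf.hausdorffMeasure_imageBoundary ht]
    exact ENNReal.ofReal_lt_top
  · rw [hausdorffMeasure_imageBoundary_of_eq_add_mul_pow hn hf ht]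
    exact ENNReal.ofReal_lt_top

lemma mixedLength_nonneg (ht : t ∈ Ioo (0 : ℝ) 1) : 0 ≤ mixedLength β f t :=
  div_nonneg ENNReal.toReal_nonneg
    (Real.rpow_nonneg (mul_nonneg Real.two_pi_pos.le ht.1.le) β)

lemma UnivalentOnDisc.deriv_ne_zero (hf : UnivalentOnDisc f) :
    ∀ z ∈ Metric.ball (0 : ℂ) 1, deriv f z ≠ 0 := fun _ hz =>
  deriv_ne_zero_of_injOn Metric.isOpen_ball hf.1 hf.2 hz

lemma UnivalentOnDisc.mixedLength_eq (hf : UnivalentOnDisc f) (ht : t ∈ Ioo (0 : ℝ) 1) :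
    mixedLength β f t =
      (2 * Real.pi * t) ^ (1 - β) * Real.circleAverage (fun z => ‖deriv f z‖) 0 t := by
  have hpos : 0 < 2 * Real.pi * t := mul_pos Real.two_pi_pos ht.1
  have hav : 0 ≤ Real.circleAverage (fun z => ‖deriv f z‖) 0 t :=
    Real.circleAverage_nonneg_of_nonneg fun z _ => norm_nonneg _
  rw [mixedLength, boundaryLength, hf.hausdorffMeasure_imageBoundary ht,
    ENNReal.toReal_ofReal (by positivity), Real.rpow_sub hpos, Real.rpow_one]
  ring

lemma mixedLength_of_eq_add_mul_pow {a₀ a : ℂ} {n : ℕ} (hn : 1 ≤ n)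
    (hf : ∀ z ∈ Metric.ball (0 : ℂ) 1, f z = a₀ + a * z ^ n) (ht : t ∈ Ioo (0 : ℝ) 1) :
    mixedLength β f t = ‖a‖ * (2 * Real.pi) ^ (1 - β) * t ^ (n - β) := by
  have ht0 := ht.1
  rw [mixedLength, boundaryLength, hausdorffMeasure_imageBoundary_of_eq_add_mul_pow hn hf ht,
    ENNReal.toReal_ofReal (by positivity), Real.mul_rpow Real.two_pi_pos.le ht0.le,
    Real.rpow_sub Real.two_pi_pos, Real.rpow_sub ht0, Real.rpow_one, Real.rpow_natCast]
  ring

/-- The limit of the mixed length at the origin. -/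
noncomputable def mixedLengthAtZero (β : ℝ) (f : ℂ → ℂ) : ℝ :=
  if β = 1 then ‖deriv f 0‖ else 0

lemma mixedLength_eq_of_exceptionalMap (hf : ExceptionalMap β f) (ht : t ∈ Ioo (0 : ℝ) 1) :
    mixedLength β f t = mixedLengthAtZero β f := by
  rcases hf with ⟨hβ, a, hf⟩ | ⟨rfl, a, b, hf⟩
  · have hf' : ∀ z ∈ Metric.ball (0 : ℂ) 1, f z = a + 0 * z ^ 1 := by simpa using hf
    rw [mixedLength_of_eq_add_mul_pow le_rfl hf' ht, mixedLengthAtZero, if_neg hβ.ne]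
    simp
  · have hf' : ∀ z ∈ Metric.ball (0 : ℂ) 1, f z = a + b * z ^ 1 := by simpa using hf
    rw [mixedLength_of_eq_add_mul_pow le_rfl hf' ht, mixedLengthAtZero, if_pos rfl,
      deriv_zero_of_eq_add_mul_pow hf']
    simp

lemma tendsto_mul_rpow_zero {c γ : ℝ} (hγ : 0 < γ) :
    Tendsto (fun t : ℝ => (c * t) ^ γ) (𝓝[>] 0) (𝓝 0) := by
  have h1 : ContinuousAt (fun t : ℝ => (c * t) ^ γ) 0 :=
    (continuousAt_const.mul continuousAt_id).rpow_const (Or.inr hγ.le)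
  have h2 := h1.tendsto.mono_left (nhdsWithin_le_nhds (s := Ioi 0))
  simpa [Real.zero_rpow hγ.ne'] using h2

lemma tendsto_mixedLength (hβ1 : β ≤ 1) (hf : UnivalentOnDisc f ∨ MonomialOnDisc f) :
    Tendsto (mixedLength β f) (𝓝[>] 0) (𝓝 (mixedLengthAtZero β f)) := by
  have hI : Ioo (0 : ℝ) 1 ∈ 𝓝[>] (0 : ℝ) := Ioo_mem_nhdsGT one_pos
  rcases hf with hf | ⟨a₀, a, n, hn, hf⟩
  · have hM := tendsto_circleAverage_norm one_pos (hf.1.deriv Metric.isOpen_ball)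
      hf.deriv_ne_zero
    have hev : (fun t => (2 * Real.pi * t) ^ (1 - β) *
        Real.circleAverage (fun z => ‖deriv f z‖) 0 t) =ᶠ[𝓝[>] 0] mixedLength β f := by
      filter_upwards [hI] with t ht using (hf.mixedLength_eq ht).symm
    refine Tendsto.congr' hev ?_
    rcases hβ1.eq_or_lt with rfl | hβ
    · simpa [mixedLengthAtZero] using hM
    · rw [mixedLengthAtZero, if_neg hβ.ne]
      simpa using (tendsto_mul_rpow_zero (sub_pos.2 hβ)).mul hM
  · have hev : (fun t => ‖a‖ * (2 * Real.pi) ^ (1 - β) * t ^ (n - β)) =ᶠ[𝓝[>] 0]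
        mixedLength β f := by
      filter_upwards [hI] with t ht using (mixedLength_of_eq_add_mul_pow hn hf ht).symm
    -- Only here does the exponent `n - β` vanish, and then `f` is affine and the mixed length
    -- constant.
    by_cases hcase : β = 1 ∧ n = 1
    · obtain ⟨rfl, rfl⟩ := hcase
      refine tendsto_const_nhds.congr' ?_
      filter_upwards [hI] with t ht
      exact (mixedLength_eq_of_exceptionalMap
        (Or.inr ⟨rfl, a₀, a, by simpa using hf⟩) ht).symm
    have hpos : 0 < n - β := by
      have : (1 : ℝ) ≤ n := by exact_mod_cast hn
      rcases hβ1.eq_or_lt with rfl | hβ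
      · have : n ≠ 1 := fun h => hcase ⟨rfl, h⟩
        have : (2 : ℝ) ≤ n := by exact_mod_cast (by omega : 2 ≤ n)
        linarith
      · linarith
    have h0 : mixedLengthAtZero β f = 0 := by
      rw [mixedLengthAtZero, deriv_zero_of_eq_add_mul_pow hf]
      split_ifs with h
      · have : n - 1 ≠ 0 := by
          have : n ≠ 1 := fun h' => hcase ⟨h, h'⟩
          omega
        simp [this]
      · rfl
    refine Tendsto.congr' hev ?_
    rw [h0]
    simpa using (tendsto_mul_rpow_zero (c := 1) hpos).const_mul
      (‖a‖ * (2 * Real.pi) ^ (1 - β))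

/-- For univalent `f` and `β < 1`, the factor `(2πt)^(1-β)` is strictly increasing and the mean of
`|f'|` is positive and nondecreasing. For `β = 1` only the mean remains, and it is strict unless
`f'` is constant. -/
lemma mixedLength_strictMonoOn (hβ1 : β ≤ 1) (hf : UnivalentOnDisc f ∨ MonomialOnDisc f)
    (hexc : ¬ ExceptionalMap β f) : StrictMonoOn (mixedLength β f) (Ioo 0 1) := by
  rcases hf with hf | ⟨a₀, a, n, hn, hf⟩
  · have hd := hf.1.deriv Metric.isOpen_ball
    intro s hs t ht hst
    rw [hf.mixedLength_eq hs, hf.mixedLength_eq ht]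
    have hs0 := hs.1
    have hpi := Real.pi_pos
    rcases hβ1.eq_or_lt with rfl | hβ
    · rw [sub_self, Real.rpow_zero, Real.rpow_zero, one_mul, one_mul]
      refine circleAverage_norm_strictMonoOn hd hf.deriv_ne_zero ?_ hs ht hst
      rintro ⟨b, hb⟩
      refine hexc (Or.inr ⟨rfl, f 0, b, fun z hz => ?_⟩)
      have hdiff : DifferentiableOn ℂ (fun z => f z - b * z) (Metric.ball 0 1) := by
        have := hf.1
        fun_prop
      have := Metric.isOpen_ball.is_const_of_deriv_eq_zero
        (convex_ball (0 : ℂ) 1).isPreconnected hdiff (fun w hw => ?_) hz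
        (Metric.mem_ball_self one_pos)
      · simp only [mul_zero, sub_zero] at this
        rw [← this]
        ring
      · have h1 := (hf.1.differentiableAt (Metric.isOpen_ball.mem_nhds hw)).hasDerivAt
        rw [hb w hw] at h1
        have h2 : HasDerivAt (fun z => b * z) b w := by
          simpa using (hasDerivAt_id w).const_mul b
        simpa using! (h1.sub h2).deriv
    · have hmono := circleAverage_norm_monotoneOn hd hf.deriv_ne_zero hs ht hst.le
      have hpos := (norm_pos_iff.2 (hf.deriv_ne_zero 0 (Metric.mem_ball_self one_pos))).trans_le
        (norm_le_circleAverage_norm hd hf.deriv_ne_zero hs)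
      have hrpow : (2 * Real.pi * s) ^ (1 - β) < (2 * Real.pi * t) ^ (1 - β) :=
        Real.rpow_lt_rpow (by positivity) (by gcongr) (sub_pos.2 hβ)
      exact mul_lt_mul hrpow hmono hpos (by have := ht.1; positivity)
  · have ha : a ≠ 0 := by
      rintro rfl
      rcases hβ1.eq_or_lt with rfl | hβ
      · exact hexc (Or.inr ⟨rfl, a₀, 0, by simpa using hf⟩)
      · exact hexc (Or.inl ⟨hβ, a₀, by simpa using hf⟩)
    have hpos : 0 < n - β := by
      have : (1 : ℝ) ≤ n := by exact_mod_cast hn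
      rcases hβ1.eq_or_lt with rfl | hβ
      · have : n ≠ 1 := by
          rintro rfl
          exact hexc (Or.inr ⟨rfl, a₀, a, by simpa using hf⟩)
        have : (2 : ℝ) ≤ n := by exact_mod_cast (by omega : 2 ≤ n)
        linarith
      · linarith
    have ha' : 0 < ‖a‖ := norm_pos_iff.2 ha
    have hpi := Real.pi_pos
    intro s hs t ht hst
    rw [mixedLength_of_eq_add_mul_pow hn hf hs, mixedLength_of_eq_add_mul_pow hn hf ht]
    have := Real.rpow_lt_rpow hs.1.le hst hpos
    gcongr

lemma mixedLength_monotoneOn (hβ1 : β ≤ 1) (hf : UnivalentOnDisc f ∨ MonomialOnDisc f) :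
    MonotoneOn (mixedLength β f) (Ioo 0 1) := by
  by_cases hexc : ExceptionalMap β f
  · intro s hs t ht _
    rw [mixedLength_eq_of_exceptionalMap hexc hs, mixedLength_eq_of_exceptionalMap hexc ht]
  · exact (mixedLength_strictMonoOn hβ1 hf hexc).monotoneOn

end MixedLength

/-! ### The weight and integrals against it -/

section WeightedMean

variable {α : ℝ}

/-- The endpoint `1` is excluded because `α` may be negative. -/
lemma continuousOn_discWeight : ContinuousOn (discWeight α) (Ico 0 1) := by
  unfold discWeight
  refine ContinuousOn.mul (ContinuousOn.rpow_const (by fun_prop) fun t ht => Or.inl ?_)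
    (by fun_prop)
  have : t ^ 2 < 1 := by nlinarith [ht.1, ht.2]
  linarith

lemma discWeight_pos {t : ℝ} (ht : t ∈ Ioo (0 : ℝ) 1) : 0 < discWeight α t := by
  have h1 : t ^ 2 < 1 := by nlinarith [ht.1, ht.2]
  have h0 := ht.1
  exact mul_pos (Real.rpow_pos_of_pos (by linarith) α) (by linarith)

lemma intervalIntegrable_discWeight {r s : ℝ} (hr : r ∈ Ico (0 : ℝ) 1) (hs : s ∈ Ico (0 : ℝ) 1) :
    IntervalIntegrable (discWeight α) volume r s :=
  (continuousOn_discWeight.mono (ordConnected_Ico.uIcc_subset hr hs)).intervalIntegrable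

lemma discNu_sub {r s : ℝ} (hr : r ∈ Ico (0 : ℝ) 1) (hs : s ∈ Ico (0 : ℝ) 1) :
    discNu α s - discNu α r = ∫ t in r..s, discWeight α t :=
  intervalIntegral.integral_interval_sub_left
    (intervalIntegrable_discWeight ⟨le_rfl, one_pos⟩ hs)
    (intervalIntegrable_discWeight ⟨le_rfl, one_pos⟩ hr)

lemma discNu_zero : discNu α 0 = 0 := intervalIntegral.integral_same

lemma discNu_strictMonoOn : StrictMonoOn (discNu α) (Ico 0 1) := by
  intro r hr s hs hrs
  rw [← sub_pos, discNu_sub hr hs]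
  exact intervalIntegral.intervalIntegral_pos_of_pos_on (intervalIntegrable_discWeight hr hs)
    (fun t ht => discWeight_pos ⟨hr.1.trans_lt ht.1, ht.2.trans hs.2⟩) hrs

lemma discNu_pos {r : ℝ} (hr : r ∈ Ioo (0 : ℝ) 1) : 0 < discNu α r := by
  rw [← discNu_zero (α := α)]
  exact discNu_strictMonoOn ⟨le_rfl, one_pos⟩ ⟨hr.1.le, hr.2⟩ hr.1

variable {Φ : ℝ → ℝ}

/-- On `(0, s]` a monotone `Φ` is measurable and bounded by `Φ s`. -/
lemma intervalIntegrable_mul_discWeight (hΦ : MonotoneOn Φ (Ioo 0 1))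
    (hΦ0 : ∀ t ∈ Ioo (0 : ℝ) 1, 0 ≤ Φ t) {r s : ℝ} (hr : r ∈ Ico (0 : ℝ) 1)
    (hs : s ∈ Ico (0 : ℝ) 1) :
    IntervalIntegrable (fun t => Φ t * discWeight α t) volume r s := by
  suffices h : ∀ s ∈ Ico (0 : ℝ) 1,
      IntervalIntegrable (fun t => Φ t * discWeight α t) volume 0 s from (h r hr).symm.trans (h s hs)
  intro s hs
  have hw := intervalIntegrable_discWeight (α := α) ⟨le_rfl, one_pos⟩ hs
  rw [intervalIntegrable_iff_integrableOn_Ioc_of_le hs.1] at hw ⊢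
  have hsub : Ioc 0 s ⊆ Ioo 0 1 := fun t ht => ⟨ht.1, ht.2.trans_lt hs.2⟩
  refine hw.bdd_mul (c := Φ s) ?_ ?_
  · exact (aemeasurable_restrict_of_monotoneOn measurableSet_Ioc
      (hΦ.mono hsub)).aestronglyMeasurable
  · refine (ae_restrict_iff' measurableSet_Ioc).2 (Eventually.of_forall fun t ht => ?_)
    rw [Real.norm_of_nonneg (hΦ0 t (hsub ht))]
    exact hΦ (hsub ht) (hsub ⟨ht.1.trans_le ht.2, le_rfl⟩) ht.2

/-- Bounds for the integral against the disc weight, in terms of bounds for the integrand. -/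
lemma integral_mul_discWeight_le (hΦ : MonotoneOn Φ (Ioo 0 1))
    (hΦ0 : ∀ t ∈ Ioo (0 : ℝ) 1, 0 ≤ Φ t) {r s c : ℝ} (hr : r ∈ Ico (0 : ℝ) 1)
    (hs : s ∈ Ico (0 : ℝ) 1) (hrs : r ≤ s) (hc : ∀ t ∈ Ioo r s, Φ t ≤ c) :
    ∫ t in r..s, Φ t * discWeight α t ≤ c * (discNu α s - discNu α r) := by
  rw [discNu_sub hr hs, ← intervalIntegral.integral_const_mul]
  refine intervalIntegral.integral_mono_on_of_le_Ioo hrs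
    (intervalIntegrable_mul_discWeight hΦ hΦ0 hr hs)
    ((intervalIntegrable_discWeight hr hs).const_mul c) fun t ht => ?_
  exact mul_le_mul_of_nonneg_right (hc t ht)
    (discWeight_pos ⟨hr.1.trans_lt ht.1, ht.2.trans hs.2⟩).le

lemma le_integral_mul_discWeight (hΦ : MonotoneOn Φ (Ioo 0 1))
    (hΦ0 : ∀ t ∈ Ioo (0 : ℝ) 1, 0 ≤ Φ t) {r s c : ℝ} (hr : r ∈ Ico (0 : ℝ) 1)
    (hs : s ∈ Ico (0 : ℝ) 1) (hrs : r ≤ s) (hc : ∀ t ∈ Ioo r s, c ≤ Φ t) :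
    c * (discNu α s - discNu α r) ≤ ∫ t in r..s, Φ t * discWeight α t := by
  rw [discNu_sub hr hs, ← intervalIntegral.integral_const_mul]
  refine intervalIntegral.integral_mono_on_of_le_Ioo hrs
    ((intervalIntegrable_discWeight hr hs).const_mul c)
    (intervalIntegrable_mul_discWeight hΦ hΦ0 hr hs) fun t ht => ?_
  exact mul_le_mul_of_nonneg_right (hc t ht)
    (discWeight_pos ⟨hr.1.trans_lt ht.1, ht.2.trans hs.2⟩).le

end WeightedMean

/-! ### Increments of weighted means of monotone functions -/

section WeightedMeanMonotone

variable {α : ℝ} {Φ : ℝ → ℝ}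

/-- The mean of `Φ` over `(0, r)` with respect to the disc weight. -/
noncomputable def discMean (α : ℝ) (Φ : ℝ → ℝ) (r : ℝ) : ℝ :=
  (∫ t in (0 : ℝ)..r, Φ t * discWeight α t) / discNu α r

lemma discMean_le (hΦ : MonotoneOn Φ (Ioo 0 1)) (hΦ0 : ∀ t ∈ Ioo (0 : ℝ) 1, 0 ≤ Φ t) {r : ℝ}
    (hr : r ∈ Ioo (0 : ℝ) 1) : discMean α Φ r ≤ Φ r := by
  have h := integral_mul_discWeight_le (α := α) hΦ hΦ0 (left_mem_Ico.2 one_pos)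
    (Ioo_subset_Ico_self hr) hr.1.le fun t ht => hΦ ⟨ht.1, ht.2.trans hr.2⟩ hr ht.2.le
  rw [discNu_zero, sub_zero] at h
  exact (div_le_iff₀ (discNu_pos hr)).2 h

lemma le_discMean (hΦ : MonotoneOn Φ (Ioo 0 1)) (hΦ0 : ∀ t ∈ Ioo (0 : ℝ) 1, 0 ≤ Φ t) {r c : ℝ}
    (hr : r ∈ Ioo (0 : ℝ) 1) (hc : ∀ t ∈ Ioo (0 : ℝ) 1, c ≤ Φ t) : c ≤ discMean α Φ r := by
  have h := le_integral_mul_discWeight (α := α) hΦ hΦ0 (left_mem_Ico.2 one_pos)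
    (Ioo_subset_Ico_self hr) hr.1.le fun t ht => hc t ⟨ht.1, ht.2.trans hr.2⟩
  rw [discNu_zero, sub_zero] at h
  exact (le_div_iff₀ (discNu_pos hr)).2 h

lemma integral_eq_discMean_mul {r : ℝ} (hr : r ∈ Ioo (0 : ℝ) 1) :
    ∫ t in (0 : ℝ)..r, Φ t * discWeight α t = discMean α Φ r * discNu α r :=
  (div_mul_cancel₀ _ (discNu_pos hr).ne').symm

lemma discMean_sub (hΦ : MonotoneOn Φ (Ioo 0 1)) (hΦ0 : ∀ t ∈ Ioo (0 : ℝ) 1, 0 ≤ Φ t)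
    {r s : ℝ} (hr : r ∈ Ioo (0 : ℝ) 1) (hs : s ∈ Ioo (0 : ℝ) 1) :
    (discMean α Φ s - discMean α Φ r) * discNu α s =
      (∫ t in r..s, Φ t * discWeight α t) - discMean α Φ r * (discNu α s - discNu α r) := by
  have h := intervalIntegral.integral_add_adjacent_intervals
    (intervalIntegrable_mul_discWeight (α := α) hΦ hΦ0 (left_mem_Ico.2 one_pos)
      (Ioo_subset_Ico_self hr))
    (intervalIntegrable_mul_discWeight (α := α) hΦ hΦ0 (Ioo_subset_Ico_self hr)
      (Ioo_subset_Ico_self hs))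
  rw [integral_eq_discMean_mul hr, integral_eq_discMean_mul hs] at h
  linear_combination -h

lemma le_discMean_sub (hΦ : MonotoneOn Φ (Ioo 0 1)) (hΦ0 : ∀ t ∈ Ioo (0 : ℝ) 1, 0 ≤ Φ t)
    {r s : ℝ} (hr : r ∈ Ioo (0 : ℝ) 1) (hs : s ∈ Ioo (0 : ℝ) 1) (hrs : r < s) :
    (Φ r - discMean α Φ r) * (1 - discNu α r / discNu α s) ≤
      discMean α Φ s - discMean α Φ r := by
  have hν := discNu_pos (α := α) hs
  have h := le_integral_mul_discWeight (α := α) hΦ hΦ0 (Ioo_subset_Ico_self hr)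
    (Ioo_subset_Ico_self hs) hrs.le
    fun t ht => hΦ hr ⟨hr.1.trans ht.1, ht.2.trans hs.2⟩ ht.1.le
  rw [one_sub_div hν.ne', ← mul_div_assoc, div_le_iff₀ hν, discMean_sub hΦ hΦ0 hr hs]
  linarith

lemma discMean_sub_le (hΦ : MonotoneOn Φ (Ioo 0 1)) (hΦ0 : ∀ t ∈ Ioo (0 : ℝ) 1, 0 ≤ Φ t)
    {r s : ℝ} (hr : r ∈ Ioo (0 : ℝ) 1) (hs : s ∈ Ioo (0 : ℝ) 1) (hrs : r < s) :
    discMean α Φ s - discMean α Φ r ≤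
      (Φ s - discMean α Φ r) * (1 - discNu α r / discNu α s) := by
  have hν := discNu_pos (α := α) hs
  have h := integral_mul_discWeight_le (α := α) hΦ hΦ0 (Ioo_subset_Ico_self hr)
    (Ioo_subset_Ico_self hs) hrs.le
    fun t ht => hΦ ⟨hr.1.trans ht.1, ht.2.trans hs.2⟩ hs ht.2.le
  rw [one_sub_div hν.ne', ← mul_div_assoc, le_div_iff₀ hν, discMean_sub hΦ hΦ0 hr hs]
  linarith

lemma one_sub_discNu_div_pos {r s : ℝ} (hr : r ∈ Ioo (0 : ℝ) 1) (hs : s ∈ Ioo (0 : ℝ) 1)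
    (hrs : r < s) : 0 < 1 - discNu α r / discNu α s := by
  rw [sub_pos, div_lt_one (discNu_pos hs)]
  exact discNu_strictMonoOn (Ioo_subset_Ico_self hr) (Ioo_subset_Ico_self hs) hrs

/-- This is `log x < x - 1` at `x = ν(r)/ν(s) ≠ 1`. -/
lemma one_sub_discNu_div_lt_log_sub {r s : ℝ} (hr : r ∈ Ioo (0 : ℝ) 1)
    (hs : s ∈ Ioo (0 : ℝ) 1) (hrs : r < s) :
    1 - discNu α r / discNu α s < Real.log (discNu α s) - Real.log (discNu α r) := by
  have hνr := discNu_pos (α := α) hr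
  have hνs := discNu_pos (α := α) hs
  have h1 := one_sub_discNu_div_pos (α := α) hr hs hrs
  have h2 := Real.log_lt_sub_one_of_pos (div_pos hνr hνs) (by linarith)
  rw [Real.log_div hνr.ne' hνs.ne'] at h2
  linarith

lemma discMean_monotoneOn (hΦ : MonotoneOn Φ (Ioo 0 1))
    (hΦ0 : ∀ t ∈ Ioo (0 : ℝ) 1, 0 ≤ Φ t) : MonotoneOn (discMean α Φ) (Ioo 0 1) := by
  intro r hr s hs hrs
  rcases hrs.eq_or_lt with rfl | hrs
  · exact le_rfl
  · have h1 := le_discMean_sub (α := α) hΦ hΦ0 hr hs hrs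
    have h2 := mul_nonneg (sub_nonneg.2 (discMean_le (α := α) hΦ hΦ0 hr))
      (one_sub_discNu_div_pos (α := α) hr hs hrs).le
    linarith

/-- Start from `r/2`, where the mean is at most `Φ(r/2) < Φ(r)`. Passing to `r` closes only the
fraction `1 - ν(r/2)/ν(r) < 1` of the gap to `Φ(r)`, at most. -/
lemma discMean_lt (hΦ : StrictMonoOn Φ (Ioo 0 1)) (hΦ0 : ∀ t ∈ Ioo (0 : ℝ) 1, 0 ≤ Φ t) {r : ℝ}
    (hr : r ∈ Ioo (0 : ℝ) 1) : discMean α Φ r < Φ r := by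
  have hq : r / 2 ∈ Ioo (0 : ℝ) 1 := ⟨by linarith [hr.1], by linarith [hr.1, hr.2]⟩
  have hqr : r / 2 < r := by linarith [hr.1]
  have h1 := discMean_sub_le (α := α) hΦ.monotoneOn hΦ0 hq hr hqr
  have h2 := discMean_le (α := α) hΦ.monotoneOn hΦ0 hq
  have h3 := hΦ hq hr hqr
  have h4 : 1 - discNu α (r / 2) / discNu α r < 1 :=
    sub_lt_self _ (div_pos (discNu_pos hq) (discNu_pos hr))
  have h5 := mul_lt_mul_of_pos_left h4 (sub_pos.2 (h2.trans_lt h3))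
  linarith

lemma discMean_strictMonoOn (hΦ : StrictMonoOn Φ (Ioo 0 1))
    (hΦ0 : ∀ t ∈ Ioo (0 : ℝ) 1, 0 ≤ Φ t) : StrictMonoOn (discMean α Φ) (Ioo 0 1) := by
  intro r hr s hs hrs
  have h1 := le_discMean_sub (α := α) hΦ.monotoneOn hΦ0 hr hs hrs
  have h2 := mul_pos (sub_pos.2 (discMean_lt (α := α) hΦ hΦ0 hr))
    (one_sub_discNu_div_pos (α := α) hr hs hrs)
  linarith

lemma discMean_sub_le_mul_one_sub_discNu_div (hΦ : MonotoneOn Φ (Ioo 0 1))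
    (hΦ0 : ∀ t ∈ Ioo (0 : ℝ) 1, 0 ≤ Φ t) {r s c : ℝ} (hr : r ∈ Ioo (0 : ℝ) 1)
    (hs : s ∈ Ioo (0 : ℝ) 1) (hrs : r < s) (hc : ∀ t ∈ Ioo (0 : ℝ) 1, c ≤ Φ t) :
    discMean α Φ s - discMean α Φ r ≤ (Φ s - c) * (1 - discNu α r / discNu α s) := by
  refine (discMean_sub_le hΦ hΦ0 hr hs hrs).trans ?_
  have := le_discMean (α := α) hΦ hΦ0 hr hc
  have := one_sub_discNu_div_pos (α := α) hr hs hrs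
  gcongr

lemma discMean_sub_le_mul_log_sub (hΦ : MonotoneOn Φ (Ioo 0 1))
    (hΦ0 : ∀ t ∈ Ioo (0 : ℝ) 1, 0 ≤ Φ t) {r s c : ℝ} (hr : r ∈ Ioo (0 : ℝ) 1)
    (hs : s ∈ Ioo (0 : ℝ) 1) (hrs : r < s) (hc : ∀ t ∈ Ioo (0 : ℝ) 1, c ≤ Φ t) :
    discMean α Φ s - discMean α Φ r ≤
      (Φ s - c) * (Real.log (discNu α s) - Real.log (discNu α r)) :=
  (discMean_sub_le_mul_one_sub_discNu_div hΦ hΦ0 hr hs hrs hc).trans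
    (mul_le_mul_of_nonneg_left (one_sub_discNu_div_lt_log_sub hr hs hrs).le
      (sub_nonneg.2 (hc s hs)))

lemma discMean_sub_lt_mul_log_sub (hΦ : StrictMonoOn Φ (Ioo 0 1))
    (hΦ0 : ∀ t ∈ Ioo (0 : ℝ) 1, 0 ≤ Φ t) {r s c : ℝ} (hr : r ∈ Ioo (0 : ℝ) 1)
    (hs : s ∈ Ioo (0 : ℝ) 1) (hrs : r < s) (hc : ∀ t ∈ Ioo (0 : ℝ) 1, c ≤ Φ t) :
    discMean α Φ s - discMean α Φ r <
      (Φ s - c) * (Real.log (discNu α s) - Real.log (discNu α r)) :=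
  (discMean_sub_le_mul_one_sub_discNu_div hΦ.monotoneOn hΦ0 hr hs hrs hc).trans_lt
    (mul_lt_mul_of_pos_left (one_sub_discNu_div_lt_log_sub hr hs hrs)
      (sub_pos.2 ((hc r hr).trans_lt (hΦ hr hs hrs))))

lemma tendsto_discMean (hΦ : MonotoneOn Φ (Ioo 0 1)) (hΦ0 : ∀ t ∈ Ioo (0 : ℝ) 1, 0 ≤ Φ t)
    {c : ℝ} (hc : ∀ t ∈ Ioo (0 : ℝ) 1, c ≤ Φ t) (hlim : Tendsto Φ (𝓝[>] 0) (𝓝 c)) :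
    Tendsto (discMean α Φ) (𝓝[>] 0) (𝓝 c) := by
  have hI : Ioo (0 : ℝ) 1 ∈ 𝓝[>] (0 : ℝ) := Ioo_mem_nhdsGT one_pos
  refine tendsto_of_tendsto_of_tendsto_of_le_of_le' tendsto_const_nhds hlim ?_ ?_
  · filter_upwards [hI] with r hr using le_discMean hΦ hΦ0 hr hc
  · filter_upwards [hI] with r hr using discMean_le hΦ hΦ0 hr

lemma MonotoneOn.le_of_tendsto_nhdsGT_zero (hΦ : MonotoneOn Φ (Ioo 0 1)) {c : ℝ}
    (hlim : Tendsto Φ (𝓝[>] 0) (𝓝 c)) : ∀ t ∈ Ioo (0 : ℝ) 1, c ≤ Φ t := by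
  intro t ht
  refine le_of_tendsto hlim ?_
  filter_upwards [Ioo_mem_nhdsGT ht.1] with s hs
  exact hΦ ⟨hs.1, hs.2.trans ht.2⟩ ht hs.2.le

lemma MonotoneOn.le_of_tendsto_nhdsLT_one (hΦ : MonotoneOn Φ (Ioo 0 1)) {c : ℝ}
    (hlim : Tendsto Φ (𝓝[<] 1) (𝓝 c)) : ∀ t ∈ Ioo (0 : ℝ) 1, Φ t ≤ c := by
  intro t ht
  refine ge_of_tendsto hlim ?_
  filter_upwards [Ioo_mem_nhdsLT ht.2] with s hs
  exact hΦ ht ⟨ht.1.trans hs.1, hs.2⟩ hs.1.le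

end WeightedMeanMonotone

/-! ### The main theorem -/

theorem theorem2 (α β : ℝ) (hβ0 : 0 ≤ β) (hβ1 : β ≤ 1) (f : ℂ → ℂ)
    (hf : UnivalentOnDisc f ∨ MonomialOnDisc f) :
    -- the lengths are finite and the weighted means are well defined
    (∀ t ∈ Ioo (0 : ℝ) 1, Measure.hausdorffMeasure 1 (imageBoundary f t) < ⊤) ∧
    (∀ r ∈ Ioo (0 : ℝ) 1,
      IntervalIntegrable (fun t => mixedLength β f t * discWeight α t) volume 0 r) ∧
    -- strict monotonicity, except for the exceptional maps
    (StrictMonoOn (meanMixedLength α β f) (Ioo 0 1) ↔ ¬ ExceptionalMap β f) ∧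
    -- the limit at the origin
    (β < 1 → Tendsto (meanMixedLength α β f) (𝓝[>] 0) (𝓝 0)) ∧
    (β = 1 → Tendsto (meanMixedLength α β f) (𝓝[>] 0) (𝓝 ‖deriv f 0‖)) ∧
    -- the bound with respect to `log ν_α`; `Φ₀` and `Φ₁` are the limits of the mixed length
    (∃ Φ₀ : ℝ, Tendsto (mixedLength β f) (𝓝[>] 0) (𝓝 Φ₀) ∧
      ∀ Φ₁ : ℝ, Tendsto (mixedLength β f) (𝓝[<] 1) (𝓝 Φ₁) →
        (∀ r s : ℝ, 0 < r → r < s → s < 1 →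
          0 ≤ (meanMixedLength α β f s - meanMixedLength α β f r) /
                (Real.log (discNu α s) - Real.log (discNu α r)) ∧
          (meanMixedLength α β f s - meanMixedLength α β f r) /
                (Real.log (discNu α s) - Real.log (discNu α r))
              ≤ mixedLength β f s - Φ₀ ∧
          ((meanMixedLength α β f s - meanMixedLength α β f r) /
                (Real.log (discNu α s) - Real.log (discNu α r)) = 0
              ↔ ExceptionalMap β f) ∧
          ((meanMixedLength α β f s - meanMixedLength α β f r) /
                (Real.log (discNu α s) - Real.log (discNu α r))
              = mixedLength β f s - Φ₀ ↔ ExceptionalMap β f)) ∧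
        ∃ C : ℝ, 0 ≤ C ∧ ∀ r ∈ Ioo (0 : ℝ) 1, ∀ s ∈ Ioo (0 : ℝ) 1,
          |meanMixedLength α β f s - meanMixedLength α β f r| ≤
            C * |Real.log (discNu α s) - Real.log (discNu α r)|) := by
  have hΦ := mixedLength_monotoneOn hβ1 hf
  have hΦ0 : ∀ t ∈ Ioo (0 : ℝ) 1, 0 ≤ mixedLength β f t := fun t ht => mixedLength_nonneg ht
  have hlim := tendsto_mixedLength hβ1 hf
  have hlow := hΦ.le_of_tendsto_nhdsGT_zero hlim
  have hmean : meanMixedLength α β f = discMean α (mixedLength β f) := rfl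
  have hmlim := tendsto_discMean (α := α) hΦ hΦ0 hlow hlim
  -- The mean is squeezed between the limit at the origin and `Φ(r)`, which coincide here.
  have hexc : ExceptionalMap β f → ∀ r ∈ Ioo (0 : ℝ) 1,
      discMean α (mixedLength β f) r = mixedLengthAtZero β f := fun he r hr =>
    le_antisymm ((discMean_le hΦ hΦ0 hr).trans (mixedLength_eq_of_exceptionalMap he hr).le)
      (le_discMean hΦ hΦ0 hr hlow)
  have hlog : ∀ r ∈ Ioo (0 : ℝ) 1, ∀ s ∈ Ioo (0 : ℝ) 1, r < s →
      0 < Real.log (discNu α s) - Real.log (discNu α r) := fun r hr s hs hrs =>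
    (one_sub_discNu_div_pos hr hs hrs).trans (one_sub_discNu_div_lt_log_sub hr hs hrs)
  rw [hmean]
  refine ⟨fun t ht => hausdorffMeasure_imageBoundary_lt_top hf ht,
    fun r hr => intervalIntegrable_mul_discWeight hΦ hΦ0 (left_mem_Ico.2 one_pos)
      (Ioo_subset_Ico_self hr),
    ⟨fun hmono he => ?_, fun he => discMean_strictMonoOn (mixedLength_strictMonoOn hβ1 hf he) hΦ0⟩,
    fun hβ => ?_, fun hβ => ?_, mixedLengthAtZero β f, hlim, fun Φ₁ hΦ₁ => ⟨?_, ?_⟩⟩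
  · have hr : (1 / 3 : ℝ) ∈ Ioo (0 : ℝ) 1 := by norm_num
    have hs : (1 / 2 : ℝ) ∈ Ioo (0 : ℝ) 1 := by norm_num
    have := hmono hr hs (by norm_num)
    rw [hexc he _ hr, hexc he _ hs] at this
    exact lt_irrefl _ this
  · rwa [mixedLengthAtZero, if_neg hβ.ne] at hmlim
  · rwa [mixedLengthAtZero, if_pos hβ] at hmlim
  · intro r s hr0 hrs hs1
    have hr : r ∈ Ioo (0 : ℝ) 1 := ⟨hr0, hrs.trans hs1⟩
    have hs : s ∈ Ioo (0 : ℝ) 1 := ⟨hr0.trans hrs, hs1⟩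
    have hl := hlog r hr s hs hrs
    refine ⟨div_nonneg (sub_nonneg.2 (discMean_monotoneOn hΦ hΦ0 hr hs hrs.le)) hl.le,
      (div_le_iff₀ hl).2 (discMean_sub_le_mul_log_sub hΦ hΦ0 hr hs hrs hlow), ?_⟩
    by_cases he : ExceptionalMap β f
    · rw [hexc he r hr, hexc he s hs, mixedLength_eq_of_exceptionalMap he hs]
      simp [he]
    · have hΦs := mixedLength_strictMonoOn hβ1 hf he
      exact ⟨iff_of_false
          (div_pos (sub_pos.2 (discMean_strictMonoOn hΦs hΦ0 hr hs hrs)) hl).ne' he,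
        iff_of_false
          ((div_lt_iff₀ hl).2 (discMean_sub_lt_mul_log_sub hΦs hΦ0 hr hs hrs hlow)).ne he⟩
  -- Only the Lipschitz bound uses the limit at `1`: it bounds `Φ(s)` uniformly, giving the constant
  -- `Φ₁ - Φ(0)`.
  · have hup := hΦ.le_of_tendsto_nhdsLT_one hΦ₁
    have hhalf : (1 / 2 : ℝ) ∈ Ioo (0 : ℝ) 1 := by norm_num
    have key : ∀ r ∈ Ioo (0 : ℝ) 1, ∀ s ∈ Ioo (0 : ℝ) 1, r < s →
        |discMean α (mixedLength β f) s - discMean α (mixedLength β f) r| ≤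
          (Φ₁ - mixedLengthAtZero β f) *
            |Real.log (discNu α s) - Real.log (discNu α r)| := by
      intro r hr s hs hrs
      have hl := hlog r hr s hs hrs
      rw [abs_of_pos hl, abs_of_nonneg (sub_nonneg.2 (discMean_monotoneOn hΦ hΦ0 hr hs hrs.le))]
      refine (discMean_sub_le_mul_log_sub hΦ hΦ0 hr hs hrs hlow).trans ?_
      have := hup s hs
      gcongr
    refine ⟨Φ₁ - mixedLengthAtZero β f, sub_nonneg.2 ((hlow _ hhalf).trans (hup _ hhalf)),
      fun r hr s hs => ?_⟩
    rcases lt_trichotomy r s with h | rfl | h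
    · exact key r hr s hs h
    · simp
    · rw [abs_sub_comm, abs_sub_comm (Real.log _)]
      exact key s hs r hr h
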